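/- Let $\mathscr A$ be a (not necessarily unital) $C^*$-algebra and let $\mathscr X$ be a Hilbert $\mathscr A$-module, that is, a complex vector space with a compatible right $\mathscr A$-action and an $\mathscr A$-valued inner product $\langle\cdot,\cdot\rangle$, linear in the second variable, which is complete for the norm $\|x\|=\|\langle x,x\rangle\|^{1/2}$. Let $\mathbb T=\{\lambda\in\mathbb C:|\lambda|=1\}$. For $x,y\in\mathscr X$ write $x\parallel y$ if $\|x+\lambda y\|=\|x\|+\|y\|$ for some $\lambda\in\mathbb T$. Let $x,y\in\mathscr X$. (a) For every faithful (that is, injective) $*$-representation $\pi$ of $\mathscr A$ on a nonzero complex Hilbert space $(\mathscr H,[\cdot,\cdot])$, the following statements are equivalent: (i) $x\parallel y$; (ii) there exist a sequence of unit vectors $\{\xi_n\}$ in $\mathscr H$ and $\lambda\in\mathbb T$ such that $$\lim_{n\to\infty}\operatorname{Re}\,[\pi(\langle x,\lambda y\rangle)\xi_n,\xi_n]=\|x\|\,\|y\|.$$ (b) Moreover, $x\parallel y$ if and only if there exist a complex Hilbert space $\mathscr H$ and a faithful $*$-representation $\pi$ of $\mathscr A$ on $\mathscr H$ for which (ii)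 holds. -/

import Mathlib

open Filter Topology

universe u v w

/-- A Hilbert `C⋆`-module over the (not necessarily unital) `C⋆`-algebra `A`: a complex vector
space `X` with a compatible *right* action of `A`, written `MulOpposite.op a • x` for `x a`, and an
`A`-valued inner product `inner A x y` that is linear in the second variable, such that `X` is
complete for the norm `‖x‖ = ‖⟨x, x⟩‖ ^ (1/2)`.

(Mathlib's `CStarModule` uses left actions with `⟨x, a y⟩ = a ⟨x, y⟩`, and has no completeness.) -/
class HilbertCStarModule (A X : Type*) [NonUnitalCStarAlgebra A] [PartialOrder A]
    [NormedAddCommGroup X] [NormedSpace ℂ X] [SMul Aᵐᵒᵖ X] extends Inner A X where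
  /-- `(x + y) a = x a + y a` -/
  add_act (x y : X) (a : A) :
    MulOpposite.op a • (x + y) = MulOpposite.op a • x + MulOpposite.op a • y
  /-- `x (a + b) = x a + x b` -/
  act_add (x : X) (a b : A) :
    MulOpposite.op (a + b) • x = MulOpposite.op a • x + MulOpposite.op b • x
  /-- `x (a b) = (x a) b` -/
  act_mul (x : X) (a b : A) :
    MulOpposite.op (a * b) • x = MulOpposite.op b • (MulOpposite.op a • x)
  /-- `γ (x a) = (γ x) a` -/
  smul_act (γ : ℂ) (x : X) (a : A) :
    γ • (MulOpposite.op a • x) = MulOpposite.op a • (γ • x)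
  /-- `γ (x a) = x (γ a)` -/
  act_smul (γ : ℂ) (x : X) (a : A) :
    γ • (MulOpposite.op a • x) = MulOpposite.op (γ • a) • x
  inner_add_right (x y z : X) : inner x (y + z) = inner x y + inner x z
  inner_smul_right (γ : ℂ) (x y : X) : inner x (γ • y) = γ • inner x y
  /-- `⟨x, y a⟩ = ⟨x, y⟩ a` -/
  inner_act_right (x y : X) (a : A) : inner x (MulOpposite.op a • y) = inner x y * a
  star_inner (x y : X) : star (inner x y) = inner y x
  inner_self_nonneg (x : X) : 0 ≤ inner x x
  inner_self_eq_zero (x : X) : inner x x = 0 ↔ x = 0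
  norm_eq_sqrt_norm_inner_self (x : X) : ‖x‖ = √‖inner x x‖
  complete : CompleteSpace X

/-- Norm-parallelism `x ∥ y` in a complex normed space. -/
def NormParallel {V : Type*} [NormedAddCommGroup V] [NormedSpace ℂ V] (x y : V) : Prop :=
  ∃ γ : ℂ, ‖γ‖ = 1 ∧ ‖x + γ • y‖ = ‖x‖ + ‖y‖

/-- For a representation `π` of `A` on a Hilbert space `H`: there are unit vectors `ξ n` in `H` and
a unimodular `γ` such that `Re [⟨x, γ y⟩ ξ n, ξ n] → ‖x‖ ‖y‖`. (The inner product of `H` is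
linear in the second variable, so `[T ξ, ξ]` is `inner ℂ ξ (T ξ)`.) -/
def ParallelAlongUnitVectors {A X H : Type*} [NonUnitalCStarAlgebra A] [PartialOrder A]
    [NormedAddCommGroup X] [NormedSpace ℂ X] [SMul Aᵐᵒᵖ X] [HilbertCStarModule A X]
    [NormedAddCommGroup H] [InnerProductSpace ℂ H] [CompleteSpace H]
    (π : A →⋆ₙₐ[ℂ] (H →L[ℂ] H)) (x y : X) : Prop :=
  ∃ (ξ : ℕ → H) (γ : ℂ), (∀ n, ‖ξ n‖ = 1) ∧ ‖γ‖ = 1 ∧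
    Tendsto (fun n => (inner ℂ (ξ n) (π (inner A x (γ • y)) (ξ n))).re) atTop (𝓝 (‖x‖ * ‖y‖))

/-! For a unit vector `ξ`, the form `(x, z) ↦ [π⟨x, z⟩ξ, ξ]` is positive semidefinite with diagonal
at most `‖x‖ ^ 2`. Expand it at `x + z`, where `z = γ • y`. If `‖x + z‖ = ‖x‖ + ‖z‖`, vectors nearly
attaining the norm push both diagonal terms and the cross term to their maxima. Conversely, a
maximal cross term forces maximal diagonal terms by Cauchy–Schwarz. Part (b) then needs only one
faithful representation on a nonzero space, a direct sum of GNS representations. -/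

theorem ContinuousLinearMap.exists_unit_seq_tendsto_opNorm {H : Type*} [NormedAddCommGroup H]
    [InnerProductSpace ℂ H] [Nontrivial H] (T : H →L[ℂ] H) :
    ∃ ξ : ℕ → H, (∀ n, ‖ξ n‖ = 1) ∧ Tendsto (fun n => ‖T (ξ n)‖) atTop (𝓝 ‖T‖) := by
  have key (n : ℕ) : ∃ ξ : H, ‖ξ‖ = 1 ∧ ‖T‖ - 1 / ((n : ℝ) + 1) ≤ ‖T ξ‖ := by
    obtain ⟨x, hx, hTx⟩ := T.exists_lt_apply_of_lt_opNorm (sub_lt_self ‖T‖ (by positivity :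
      0 < 1 / ((n : ℝ) + 1)))
    rcases eq_or_ne x 0 with rfl | hx0
    · obtain ⟨ξ, hξ⟩ := exists_norm_eq H zero_le_one
      refine ⟨ξ, hξ, hTx.le.trans ?_⟩
      simp
    · have hpos : 0 < ‖x‖ := norm_pos_iff.mpr hx0
      refine ⟨((‖x‖⁻¹ : ℝ) : ℂ) • x, ?_, hTx.le.trans ?_⟩
      · simp [norm_smul, hpos.ne']
      · rw [map_smul, norm_smul, Complex.norm_real, norm_inv, norm_norm]
        exact le_mul_of_one_le_left (norm_nonneg _) ((one_le_inv₀ hpos).mpr hx.le)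
  choose ξ hξ hT using key
  refine ⟨ξ, hξ, tendsto_of_tendsto_of_tendsto_of_le_of_le ?_ tendsto_const_nhds hT fun n => ?_⟩
  · simpa using (tendsto_const_nhds (x := ‖T‖)).sub
      (tendsto_one_div_add_atTop_nhds_zero_nat (𝕜 := ℝ))
  · simpa [hξ n] using T.le_opNorm (ξ n)

theorem inner_star_mul_self_apply {A : Type*} [NonUnitalCStarAlgebra A] {H : Type*}
    [NormedAddCommGroup H] [InnerProductSpace ℂ H] [CompleteSpace H]
    (π : A →⋆ₙₐ[ℂ] (H →L[ℂ] H)) (b : A) (ξ : H) :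
    inner ℂ ξ (π (star b * b) ξ) = (‖π b ξ‖ ^ 2 : ℝ) := by
  rw [map_mul, map_star, ContinuousLinearMap.star_eq_adjoint, mul_apply_eq_comp,
    ContinuousLinearMap.adjoint_inner_right, inner_self_eq_norm_sq_to_K]
  norm_cast

/-! ### Semi-inner products from vector states -/

section VectorStates

variable {A : Type u} {X : Type v} [NonUnitalCStarAlgebra A] [PartialOrder A]
  [NormedAddCommGroup X] [NormedSpace ℂ X] [SMul Aᵐᵒᵖ X] [HilbertCStarModule A X]
  {H : Type w} [NormedAddCommGroup H] [InnerProductSpace ℂ H] [CompleteSpace H]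
  (π : A →⋆ₙₐ[ℂ] (H →L[ℂ] H))

namespace HilbertCStarModule

theorem inner_add_left (x y z : X) : inner A (x + y) z = inner A x z + inner A y z := by
  rw [← star_inner (A := A) z, HilbertCStarModule.inner_add_right, star_add, star_inner, star_inner]

theorem inner_smul_left (γ : ℂ) (x y : X) : inner A (γ • x) y = star γ • inner A x y := by
  rw [← star_inner (A := A) y, HilbertCStarModule.inner_smul_right, star_smul, star_inner]

theorem norm_inner_self (x : X) : ‖inner A x x‖ = ‖x‖ ^ 2 := by
  rw [norm_eq_sqrt_norm_inner_self (A := A) x, Real.sq_sqrt (norm_nonneg _)]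

theorem re_inner_apply_self_le (x : X) {ξ : H} (hξ : ‖ξ‖ = 1) :
    (inner ℂ ξ (π (inner A x x) ξ)).re ≤ ‖x‖ ^ 2 := by
  calc (inner ℂ ξ (π (inner A x x) ξ)).re
      ≤ ‖inner ℂ ξ (π (inner A x x) ξ)‖ := Complex.re_le_norm _
    _ ≤ ‖ξ‖ * ‖π (inner A x x) ξ‖ := norm_inner_le_norm _ _
    _ ≤ ‖ξ‖ * (‖π (inner A x x)‖ * ‖ξ‖) := by gcongr; exact (π (inner A x x)).le_opNorm ξ
    _ ≤ ‖inner A x x‖ := by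
      simpa [hξ] using NonUnitalStarAlgHom.norm_apply_le π (inner A x x)
    _ = ‖x‖ ^ 2 := norm_inner_self x

theorem inner_apply_conj_symm (x y : X) (ξ : H) :
    starRingEnd ℂ (inner ℂ ξ (π (inner A y x) ξ)) = inner ℂ ξ (π (inner A x y) ξ) := by
  rw [inner_conj_symm, ← star_inner (A := A) y x, map_star, ContinuousLinearMap.star_eq_adjoint,
    ContinuousLinearMap.adjoint_inner_right]

theorem re_inner_apply_add_self (x z : X) (ξ : H) :
    (inner ℂ ξ (π (inner A (x + z) (x + z)) ξ)).re =
      (inner ℂ ξ (π (inner A x x) ξ)).re + (inner ℂ ξ (π (inner A z z) ξ)).re +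
        2 * (inner ℂ ξ (π (inner A x z) ξ)).re := by
  have h := congrArg Complex.re (inner_apply_conj_symm π z x ξ)
  rw [Complex.conj_re] at h
  rw [inner_add_left, HilbertCStarModule.inner_add_right, HilbertCStarModule.inner_add_right]
  simp only [map_add, add_apply, _root_.inner_add_right, Complex.add_re, ← h]
  ring

variable [StarOrderedRing A]

theorem re_inner_apply_self_nonneg (x : X) (ξ : H) :
    0 ≤ (inner ℂ ξ (π (inner A x x) ξ)).re := by
  obtain ⟨b, hb⟩ := CStarAlgebra.nonneg_iff_eq_star_mul_self.mp (inner_self_nonneg (A := A) x)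
  rw [hb, inner_star_mul_self_apply, Complex.ofReal_re]
  positivity

/-- The positive semidefinite sesquilinear form `(x, y) ↦ [π ⟨x, y⟩ ξ, ξ]`. -/
@[reducible]
noncomputable def vectorStateCore (ξ : H) : PreInnerProductSpace.Core ℂ X where
  inner x y := inner ℂ ξ (π (inner A x y) ξ)
  conj_inner_symm x y := inner_apply_conj_symm π x y ξ
  re_inner_nonneg x := re_inner_apply_self_nonneg π x ξ
  add_left x y z := by
    simp only [inner_add_left, map_add, add_apply, _root_.inner_add_right]
  smul_left x y γ := by
    simp only [inner_smul_left, map_smul, smul_apply,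
      _root_.inner_smul_right, starRingEnd_apply]

theorem re_inner_apply_sq_le (x y : X) (ξ : H) :
    (inner ℂ ξ (π (inner A x y) ξ)).re ^ 2 ≤
      (inner ℂ ξ (π (inner A x x) ξ)).re * (inner ℂ ξ (π (inner A y y) ξ)).re := by
  have h : ‖inner ℂ ξ (π (inner A x y) ξ)‖ * ‖inner ℂ ξ (π (inner A y x) ξ)‖ ≤
      (inner ℂ ξ (π (inner A x x) ξ)).re * (inner ℂ ξ (π (inner A y y) ξ)).re :=
    letI := vectorStateCore (X := X) π ξ
    InnerProductSpace.Core.inner_mul_inner_self_le (𝕜 := ℂ) x y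
  rw [← inner_apply_conj_symm π y x, RCLike.norm_conj, ← sq] at h
  refine le_trans ?_ h
  rw [← sq_abs]
  gcongr
  exact Complex.abs_re_le_norm _

theorem norm_add_eq_of_tendsto (x z : X) (ξ : ℕ → H) (hξ : ∀ n, ‖ξ n‖ = 1)
    (h : Tendsto (fun n => (inner ℂ (ξ n) (π (inner A x z) (ξ n))).re) atTop (𝓝 (‖x‖ * ‖z‖))) :
    ‖x + z‖ = ‖x‖ + ‖z‖ := by
  rcases eq_or_ne x 0 with rfl | hx
  · simp
  rcases eq_or_ne z 0 with rfl | hz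
  · simp
  have hx' : 0 < ‖x‖ := norm_pos_iff.mpr hx
  have hz' : 0 < ‖z‖ := norm_pos_iff.mpr hz
  refine le_antisymm (norm_add_le x z) (le_of_sq_le_sq ?_ (norm_nonneg _))
  -- With `r` the cross term, Cauchy–Schwarz bounds the diagonal terms below by `r ^ 2 / ‖z‖ ^ 2`
  -- and `r ^ 2 / ‖x‖ ^ 2`.
  have hlim := ((((h.pow 2).div_const (‖z‖ ^ 2)).add ((h.pow 2).div_const (‖x‖ ^ 2))).add
    (h.const_mul 2))
  have hval : (‖x‖ * ‖z‖) ^ 2 / ‖z‖ ^ 2 + (‖x‖ * ‖z‖) ^ 2 / ‖x‖ ^ 2 + 2 * (‖x‖ * ‖z‖) =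
      (‖x‖ + ‖z‖) ^ 2 := by
    field_simp
    ring
  rw [hval] at hlim
  refine le_of_tendsto' hlim fun n => ?_
  have hcs := re_inner_apply_sq_le π x z (ξ n)
  have hp := re_inner_apply_self_nonneg π x (ξ n)
  have hq := re_inner_apply_self_nonneg π z (ξ n)
  have hp' := re_inner_apply_self_le π x (hξ n)
  have hq' := re_inner_apply_self_le π z (hξ n)
  refine le_trans ?_ (re_inner_apply_self_le π (x + z) (hξ n))
  rw [re_inner_apply_add_self]
  gcongr
  · rw [div_le_iff₀ (by positivity)]
    exact hcs.trans (mul_le_mul_of_nonneg_left hq' hp)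
  · rw [div_le_iff₀ (by positivity), mul_comm]
    exact hcs.trans (mul_le_mul_of_nonneg_right hp' hq)

theorem exists_tendsto_of_norm_add_eq [Nontrivial H] (hπ : Function.Injective π) (x z : X)
    (h : ‖x + z‖ = ‖x‖ + ‖z‖) :
    ∃ ξ : ℕ → H, (∀ n, ‖ξ n‖ = 1) ∧
      Tendsto (fun n => (inner ℂ (ξ n) (π (inner A x z) (ξ n))).re) atTop (𝓝 (‖x‖ * ‖z‖)) := by
  obtain ⟨b, hb⟩ :=
    CStarAlgebra.nonneg_iff_eq_star_mul_self.mp (inner_self_nonneg (A := A) (x + z))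
  -- Since `⟨x + z, x + z⟩ = star b * b`, its vector state at `ξ n` is `‖π b (ξ n)‖ ^ 2`;
  -- injectivity makes `π` isometric, so this tends to `‖x + z‖ ^ 2`.
  obtain ⟨ξ, hξ, hT⟩ := (π b).exists_unit_seq_tendsto_opNorm
  have hnorm : ‖π b‖ ^ 2 = (‖x‖ + ‖z‖) ^ 2 := by
    rw [NonUnitalStarAlgHom.norm_map π hπ, sq, ← CStarRing.norm_star_mul_self, ← hb,
      norm_inner_self, h]
  have hlim := (((hT.pow 2).sub_const (‖x‖ ^ 2)).sub_const (‖z‖ ^ 2)).div_const 2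
  have hval : (‖π b‖ ^ 2 - ‖x‖ ^ 2 - ‖z‖ ^ 2) / 2 = ‖x‖ * ‖z‖ := by
    rw [hnorm]
    ring
  rw [hval] at hlim
  refine ⟨ξ, hξ, tendsto_of_tendsto_of_tendsto_of_le_of_le hlim tendsto_const_nhds
    (fun n => ?_) fun n => ?_⟩
  · have hsum := re_inner_apply_add_self π x z (ξ n)
    rw [hb, inner_star_mul_self_apply, Complex.ofReal_re] at hsum
    have hp := re_inner_apply_self_le π x (hξ n)
    have hq := re_inner_apply_self_le π z (hξ n)
    simp only
    linarith
  · refine le_of_sq_le_sq ((re_inner_apply_sq_le π x z (ξ n)).trans ?_) (by positivity)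
    rw [mul_pow]
    exact mul_le_mul (re_inner_apply_self_le π x (hξ n)) (re_inner_apply_self_le π z (hξ n))
      (re_inner_apply_self_nonneg π z (ξ n)) (by positivity)

theorem normParallel_iff_parallelAlongUnitVectors [Nontrivial H] (hπ : Function.Injective π)
    (x y : X) : NormParallel x y ↔ ParallelAlongUnitVectors π x y := by
  have hnorm {γ : ℂ} (hγ : ‖γ‖ = 1) : ‖γ • y‖ = ‖y‖ := by rw [norm_smul, hγ, one_mul]
  constructor
  · rintro ⟨γ, hγ, h⟩
    obtain ⟨ξ, hξ, hlim⟩ := exists_tendsto_of_norm_add_eq π hπ x (γ • y) (by rw [h, hnorm hγ])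
    exact ⟨ξ, γ, hξ, hγ, by simpa only [hnorm hγ] using hlim⟩
  · rintro ⟨ξ, γ, hξ, hγ, hlim⟩
    refine ⟨γ, hγ, ?_⟩
    rw [norm_add_eq_of_tendsto π x (γ • y) ξ hξ (by simpa only [hnorm hγ] using hlim), hnorm hγ]

end HilbertCStarModule

end VectorStates

/-! ### Gelfand–Naimark without a unit -/

section FaithfulRepresentation

open scoped ComplexOrder

variable {A : Type u} [NonUnitalCStarAlgebra A]

theorem CStarAlgebra.exists_positiveLinearMap_ne_zero [PartialOrder A] [StarOrderedRing A] {a : A}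
    (ha : 0 ≤ a) (ha0 : a ≠ 0) : ∃ f : A →ₚ[ℂ] ℂ, f a ≠ 0 := by
  have hmem : -a ∉ ProperCone.positive ℝ A := fun h =>
    ha0 (le_antisymm (neg_nonneg.mp h) ha)
  obtain ⟨g, hg, hga⟩ := ProperCone.hyperplane_separation_point _ hmem
  -- Symmetrizing kills `g'` on skew-adjoint elements, so the complex extension is real on
  -- self-adjoint ones.
  let g' : StrongDual ℝ A := g + g ∘L (starL' ℝ : A ≃L[ℝ] A)
  have hg' (x : A) : g' x = g x + g (star x) := rfl
  refine ⟨PositiveLinearMap.mk₀ (g'.extendRCLike (𝕜 := ℂ)).toLinearMap fun x hx => ?_, fun h => ?_⟩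
  · have hx' : star x = x := (IsSelfAdjoint.of_nonneg hx).star_eq
    rw [RCLike.nonneg_iff]
    constructor
    · have := hg x hx
      simp only [ContinuousLinearMap.coe_coe, StrongDual.re_extendRCLike_apply, hg', hx']
      positivity
    · simp [hg', hx']
  · have h' : RCLike.re (g'.extendRCLike (𝕜 := ℂ) a) = 0 := by
      have : g'.extendRCLike (𝕜 := ℂ) a = 0 := h
      simp [this]
    rw [StrongDual.re_extendRCLike_apply, hg', (IsSelfAdjoint.of_nonneg ha).star_eq] at h'
    rw [map_neg] at hga
    linarith

/-- With no unit to supply a cyclic vector, test the operator on the class of `star a`: the image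
has squared norm equal to the value of `f` in `ha`. -/
theorem PositiveLinearMap.gnsNonUnitalStarAlgHom_ne_zero [PartialOrder A] [StarOrderedRing A]
    (f : A →ₚ[ℂ] ℂ) {a : A} (ha : f (star (a * star a) * (a * star a)) ≠ 0) :
    f.gnsNonUnitalStarAlgHom a ≠ 0 := by
  intro h
  have h' := congrArg (fun T : f.GNS →L[ℂ] f.GNS => ‖T (f.toPreGNS (star a) : f.GNS)‖) h
  simp only [gnsNonUnitalStarAlgHom_apply_coe, UniformSpace.Completion.norm_coe,
    _root_.zero_apply, norm_zero] at h'
  apply ha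
  have := f.preGNS_norm_sq (f.leftMulMapPreGNS a (f.toPreGNS (star a)))
  rw [h'] at this
  simpa using this.symm

/-- The direct sum of a family of representations of a C⋆-algebra on Hilbert spaces. -/
noncomputable def NonUnitalStarAlgHom.directSum {ι : Type*} {H : ι → Type*}
    [∀ i, NormedAddCommGroup (H i)] [∀ i, InnerProductSpace ℂ (H i)] [∀ i, CompleteSpace (H i)]
    (π : ∀ i, A →⋆ₙₐ[ℂ] (H i →L[ℂ] H i)) : A →⋆ₙₐ[ℂ] (lp H 2 →L[ℂ] lp H 2) where
  toFun a := lp.mapCLM 2 (fun i => π i a) (norm_nonneg a)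
    fun i => NonUnitalStarAlgHom.norm_apply_le (π i) a
  map_smul' _ _ := by ext; simp
  map_zero' := by ext; simp
  map_add' _ _ := by ext; simp
  map_mul' _ _ := by ext; simp
  map_star' a := by
    rw [ContinuousLinearMap.star_eq_adjoint, ContinuousLinearMap.eq_adjoint_iff]
    intro x y
    simp only [lp.inner_eq_tsum]
    refine tsum_congr fun i => ?_
    simp [map_star, ContinuousLinearMap.star_eq_adjoint, ContinuousLinearMap.adjoint_inner_left]

theorem NonUnitalStarAlgHom.directSum_apply {ι : Type*} {H : ι → Type*}
    [∀ i, NormedAddCommGroup (H i)] [∀ i, InnerProductSpace ℂ (H i)] [∀ i, CompleteSpace (H i)]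
    (π : ∀ i, A →⋆ₙₐ[ℂ] (H i →L[ℂ] H i)) (a : A) (x : lp H 2) (i : ι) :
    directSum π a x i = π i a (x i) := rfl

theorem NonUnitalStarAlgHom.directSum_injective {ι : Type*} {H : ι → Type*}
    [∀ i, NormedAddCommGroup (H i)] [∀ i, InnerProductSpace ℂ (H i)] [∀ i, CompleteSpace (H i)]
    (π : ∀ i, A →⋆ₙₐ[ℂ] (H i →L[ℂ] H i)) (hπ : ∀ a, a ≠ 0 → ∃ i, π i a ≠ 0) :
    Function.Injective (directSum π) := by
  classical
  refine (injective_iff_map_eq_zero _).mpr fun a ha => by_contra fun ha0 => ?_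
  obtain ⟨i, hi⟩ := hπ a ha0
  refine hi (ContinuousLinearMap.ext fun ξ => ?_)
  have := directSum_apply π a (lp.single 2 i ξ) i
  rw [ha] at this
  simpa using this.symm

/-- **Gelfand–Naimark theorem**, on a nonzero Hilbert space. -/
theorem CStarAlgebra.exists_injective_representation [PartialOrder A] [StarOrderedRing A] :
    ∃ (H : Type u) (_ : NormedAddCommGroup H) (_ : InnerProductSpace ℂ H) (_ : CompleteSpace H)
      (_ : Nontrivial H) (π : A →⋆ₙₐ[ℂ] (H →L[ℂ] H)), Function.Injective π := by
  cases subsingleton_or_nontrivial A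
  -- For `A = 0` the GNS spaces vanish, so a nonzero space is supplied by hand.
  · exact ⟨EuclideanSpace ℂ PUnit.{u + 1}, inferInstance, inferInstance, inferInstance,
      inferInstance, 0, Function.injective_of_subsingleton _⟩
  · let π := NonUnitalStarAlgHom.directSum fun f : A →ₚ[ℂ] ℂ => f.gnsNonUnitalStarAlgHom
    have hπ : Function.Injective π := by
      refine NonUnitalStarAlgHom.directSum_injective _ fun a ha => ?_
      have hne : star (a * star a) * (a * star a) ≠ 0 := by
        rwa [Ne, CStarRing.star_mul_self_eq_zero_iff, CStarRing.mul_star_self_eq_zero_iff]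
      obtain ⟨f, hf⟩ := exists_positiveLinearMap_ne_zero (star_mul_self_nonneg _) hne
      exact ⟨f, f.gnsNonUnitalStarAlgHom_ne_zero hf⟩
    refine ⟨_, inferInstance, inferInstance, inferInstance, ?_, π, hπ⟩
    by_contra hsub
    rw [not_nontrivial_iff_subsingleton] at hsub
    exact not_subsingleton A hπ.subsingleton

end FaithfulRepresentation

theorem mainTheorem1 {A : Type u} {X : Type v}
    [NonUnitalCStarAlgebra A] [PartialOrder A] [StarOrderedRing A]
    [NormedAddCommGroup X] [NormedSpace ℂ X] [SMul Aᵐᵒᵖ X] [HilbertCStarModule A X]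
    (x y : X) :
    (∀ (H : Type w) [NormedAddCommGroup H] [InnerProductSpace ℂ H] [CompleteSpace H]
        [Nontrivial H] (π : A →⋆ₙₐ[ℂ] (H →L[ℂ] H)), Function.Injective π →
        (NormParallel x y ↔ ParallelAlongUnitVectors π x y)) ∧
    (NormParallel x y ↔
      ∃ (H : Type u) (_ : NormedAddCommGroup H) (_ : InnerProductSpace ℂ H)
        (_ : CompleteSpace H) (π : A →⋆ₙₐ[ℂ] (H →L[ℂ] H)),
        Function.Injective π ∧ ParallelAlongUnitVectors π x y) := by
  refine ⟨fun H _ _ _ _ π hπ =>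
    HilbertCStarModule.normParallel_iff_parallelAlongUnitVectors π hπ x y, fun h => ?_, ?_⟩
  · obtain ⟨H, _, _, _, _, π, hπ⟩ := CStarAlgebra.exists_injective_representation (A := A)
    exact ⟨H, _, _, _, π, hπ,
      (HilbertCStarModule.normParallel_iff_parallelAlongUnitVectors π hπ x y).mp h⟩
  · rintro ⟨H, _, _, _, π, hπ, h⟩
    obtain ⟨ξ, -, hξ, -⟩ := id h
    -- The unit vectors themselves rule out `H = 0`.
    have : Nontrivial H := nontrivial_of_ne (ξ 0) 0 (norm_ne_zero_iff.mp (by simp [hξ 0]))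
    exact (HilbertCStarModule.normParallel_iff_parallelAlongUnitVectors π hπ x y).mpr h
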